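/- Let $(M,F)$ be a Finsler space of dimension $n$: $M$ is a smooth $n$-manifold and $F:TM\to\mathbb R$ satisfies (a) $F\ge 0$, with $F(x,y)=0$ iff $y=0$; (b) $F$ is $C^\infty$ on $TM\setminus\{0\}$; (c) $F(x,\lambda y)=\lambda F(x,y)$ for $\lambda>0$; (d) $g_{ij}:=\frac12\dot\partial_i\dot\partial_jF^2$ is positive definite on $TM\setminus\{0\}$. Here $(x^i,y^i)$ are the coordinates on $TM$ induced by a chart of $M$, $\partial_i=\partial/\partial x^i$, $\dot\partial_i=\partial/\partial y^i$, and repeated indices are summed. Let $(g^{ij})$ be the inverse of $(g_{ij})$ and put $\ell_i=\dot\partial_iF$, $C_{ijk}=\frac12\dot\partial_kg_{ij}$, $C^h_{ij}=C_{ijk}g^{kh}$, $C_{ijkh}=\dot\partial_hC_{ijk}$, $$T_{rijk}=FC_{rijk}-F(C_{sij}C^{s}_{rk}+C_{sjr}C^{s}_{ik}+C_{sir}C^{s}_{jk})+C_{rij}\ell_k+C_{rik}\ell_j+C_{rjk}\ell_i+C_{ijk}\ell_r,\qquad T^r_{jkh}=g^{rl}T_{ljkh},$$ $$G^i=\tfrac14g^{ih}(y^r\partial_r\dot\partial_hF^2-\partial_hF^2),\qquad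 G^i_{jkh}=\dot\partial_h\dot\partial_k\dot\partial_jG^i,\qquad L_{jkh}=-\tfrac12F\ell_iG^i_{jkh}.$$ $(M,F)$ is called a Landsberg space if the Landsberg tensor $L_{jkh}$ vanishes identically on $TM\setminus\{0\}$. Let $\sigma$ be a smooth function on $M$, $\sigma_r=\partial_r\sigma$, and $\overline F=e^{\sigma}F$. Then the Landsberg tensor of $(M,\overline F)$ is, at every point of $TM\setminus\{0\}$ and in all local coordinates, $$\overline L_{jkh}=e^{2\sigma}L_{jkh}+e^{2\sigma}F\,\sigma_rT^r_{jkh}.$$ Consequently, if $(M,F)$ is a Landsberg space, then $(M,\overline F)$ is a Landsberg space if and only if $\sigma_rT^r_{jkh}=0$ identically on $TM\setminus\{0\}$. -/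

import Mathlib

open scoped Manifold ContDiff

noncomputable section

namespace Finsler

/-- The coordinate space `ℝⁿ`. -/
abbrev E (n : ℕ) : Type := EuclideanSpace ℝ (Fin n)

section Local

/-! Objects in one system of local coordinates. A function on (an open part of) the tangent bundle
is written as `f x y`, where `x = (xⁱ)` are the coordinates of the base point and `y = (yⁱ)` those
of the supporting element. -/

variable {n : ℕ}

/-- The `i`-th coordinate vector of `ℝⁿ`. -/
def e (i : Fin n) : E n := EuclideanSpace.single i 1

/-- Partial differentiation with respect to `xⁱ`. -/
def dx (i : Fin n) (f : E n → E n → ℝ) (x y : E n) : ℝ :=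
  fderiv ℝ (fun x' => f x' y) x (e i)

/-- Partial differentiation with respect to `yⁱ`. -/
def dy (i : Fin n) (f : E n → E n → ℝ) (x y : E n) : ℝ :=
  fderiv ℝ (fun y' => f x y') y (e i)

/-- The square `F²`. -/
def sq (F : E n → E n → ℝ) (x y : E n) : ℝ := F x y ^ 2

/-- The Finsler metric tensor `g_{ij} = ½ ∂̇_i ∂̇_j F²`. -/
def metric (F : E n → E n → ℝ) (i j : Fin n) (x y : E n) : ℝ :=
  1 / 2 * dy i (dy j (sq F)) x y

/-- The matrix `(g_{ij}(x, y))`. -/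
def metricMatrix (F : E n → E n → ℝ) (x y : E n) : Matrix (Fin n) (Fin n) ℝ :=
  Matrix.of fun i j => metric F i j x y

/-- The inverse metric tensor `g^{ij}`. -/
def invMetric (F : E n → E n → ℝ) (i j : Fin n) (x y : E n) : ℝ :=
  (metricMatrix F x y)⁻¹ i j

/-- The normalized supporting element `ℓ_i = ∂̇_i F`. -/
def ell (F : E n → E n → ℝ) (i : Fin n) (x y : E n) : ℝ := dy i F x y

/-- The Cartan tensor `C_{ijk} = ½ ∂̇_k g_{ij}`. -/
def cartan (F : E n → E n → ℝ) (i j k : Fin n) (x y : E n) : ℝ :=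
  1 / 2 * dy k (metric F i j) x y

/-- `C^h_{ij} = C_{ijk} g^{kh}`. -/
def cartanUp (F : E n → E n → ℝ) (h i j : Fin n) (x y : E n) : ℝ :=
  ∑ k, cartan F i j k x y * invMetric F k h x y

/-- `C_{ijkh} = ∂̇_h C_{ijk}`. -/
def dCartan (F : E n → E n → ℝ) (i j k h : Fin n) (x y : E n) : ℝ :=
  dy h (cartan F i j k) x y

/-- The T-tensor `T_{rijk} = F C_{rijk} - F (C_{sij} C^s_{rk} + C_{sjr} C^s_{ik} + C_{sir} C^s_{jk})
  + C_{rij} ℓ_k + C_{rik} ℓ_j + C_{rjk} ℓ_i + C_{ijk} ℓ_r`. -/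
def tTensor (F : E n → E n → ℝ) (r i j k : Fin n) (x y : E n) : ℝ :=
  F x y * dCartan F r i j k x y
    - F x y * ∑ s, (cartan F s i j x y * cartanUp F s r k x y
        + cartan F s j r x y * cartanUp F s i k x y
        + cartan F s i r x y * cartanUp F s j k x y)
    + cartan F r i j x y * ell F k x y + cartan F r i k x y * ell F j x y
    + cartan F r j k x y * ell F i x y + cartan F i j k x y * ell F r x y

/-- `T^r_{jkh} = g^{rl} T_{ljkh}`. -/
def tTensorUp (F : E n → E n → ℝ) (r j k h : Fin n) (x y : E n) : ℝ :=
  ∑ l, invMetric F r l x y * tTensor F l j k h x y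

/-- The geodesic coefficients `G^i = ¼ g^{ih} (y^r ∂_r ∂̇_h F² - ∂_h F²)`. -/
def spray (F : E n → E n → ℝ) (i : Fin n) (x y : E n) : ℝ :=
  1 / 4 * ∑ h, invMetric F i h x y *
    ((∑ r, y r * dx r (dy h (sq F)) x y) - dx h (sq F) x y)

/-- The nonlinear connection `G^i_j = ∂̇_j G^i`. -/
def nonlinearConn (F : E n → E n → ℝ) (i j : Fin n) : E n → E n → ℝ := dy j (spray F i)

/-- The coefficients of the Berwald connection `G^i_{jk} = ∂̇_k G^i_j`. -/
def berwaldConn (F : E n → E n → ℝ) (i j k : Fin n) : E n → E n → ℝ :=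
  dy k (nonlinearConn F i j)

/-- The Berwald tensor `G^i_{jkh} = ∂̇_h G^i_{jk}`. -/
def berwald (F : E n → E n → ℝ) (i j k h : Fin n) : E n → E n → ℝ :=
  dy h (berwaldConn F i j k)

/-- The Landsberg tensor `L_{jkh} = -½ F ℓ_i G^i_{jkh}`. -/
def landsberg (F : E n → E n → ℝ) (j k h : Fin n) (x y : E n) : ℝ :=
  -(1 / 2) * F x y * ∑ i, ell F i x y * berwald F i j k h x y

end Local

section Global

variable {n : ℕ} {M : Type*} [TopologicalSpace M] [ChartedSpace (E n) M]

/-- The expression of `F : TM → ℝ` in the local coordinates `(xⁱ, yⁱ)` induced by a chart `φ`: the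
value of `F` at the tangent vector `yⁱ ∂/∂xⁱ` at the point `φ⁻¹(x)`. -/
def coordExpr (F : TangentBundle (𝓡 n) M → ℝ) (φ : OpenPartialHomeomorph M (E n))
    (x y : E n) : ℝ :=
  F ⟨φ.symm x, mfderiv (𝓡 n) (𝓡 n) φ.symm x y⟩

/-- `σ_r = ∂σ/∂x^r` in the chart `φ`, at the point with coordinates `x`. -/
def dsigma (σ : M → ℝ) (φ : OpenPartialHomeomorph M (E n)) (r : Fin n) (x : E n) : ℝ :=
  fderiv ℝ (fun x' => σ (φ.symm x')) x (e r)

/-- The conformal change `F̄ = e^σ F`. -/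
def conformal (σ : M → ℝ) (F : TangentBundle (𝓡 n) M → ℝ) : TangentBundle (𝓡 n) M → ℝ :=
  fun v => Real.exp (σ v.proj) * F v

/-- `F : TM → ℝ` is a Finsler structure on the smooth manifold `M`. -/
structure IsFinslerStructure [IsManifold (𝓡 n) ∞ M] (F : TangentBundle (𝓡 n) M → ℝ) : Prop where
  nonneg : ∀ v, 0 ≤ F v
  eq_zero_iff : ∀ v, F v = 0 ↔ v.snd = 0
  smooth : ContMDiffOn (𝓡 n).tangent 𝓘(ℝ, ℝ) ∞ F {v | v.snd ≠ 0}
  homogeneous : ∀ (p : M) (y : TangentSpace (𝓡 n) p) (c : ℝ), 0 < c →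
    F ⟨p, c • y⟩ = c * F ⟨p, y⟩
  posDef : ∀ φ ∈ IsManifold.maximalAtlas (𝓡 n) ∞ M, ∀ x ∈ φ.target, ∀ y : E n, y ≠ 0 →
    (metricMatrix (coordExpr F φ) x y).PosDef

/-- `(M, F)` is a Landsberg space: a Finsler space whose Landsberg tensor vanishes identically on
the slit tangent bundle. -/
def IsLandsbergian [IsManifold (𝓡 n) ∞ M] (F : TangentBundle (𝓡 n) M → ℝ) : Prop :=
  IsFinslerStructure F ∧
    ∀ φ ∈ IsManifold.maximalAtlas (𝓡 n) ∞ M, ∀ x ∈ φ.target, ∀ y : E n, y ≠ 0 →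
      ∀ j k h : Fin n, landsberg (coordExpr F φ) j k h x y = 0

end Global

end Finsler

end

/-! Fix a chart and put $w_i = F\ell_i$. The conformal change alters the geodesic coefficients by
$\sigma_r y^r y^i - \frac12 \sigma_r F^2 g^{ir}$ (`spray_localConformal`). The first term is
quadratic in $y$, so the third vertical derivative keeps only the second. The Landsberg formula thus
reduces to $w_i\,\dot\partial_h\dot\partial_k\dot\partial_j(F^2 g^{ir}) = 4F\,T^r_{jkh}$
(`sum_mul_ell_mul_pd_pd_pd`).

For this identity, start from $w_i g^{ir} = y^r$ (Euler) and differentiate three times in $y$, using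
$\dot\partial_j w_i = g_{ij}$ and $g_{ai}\dot\partial_k g^{ir} = -2C_{aik}g^{ir}$. This evaluates
$w_i$ against every derivative of $g^{ir}$ up to order three in terms of the Cartan tensor, and the
Leibniz rule then assembles the T-tensor. The equivalence for Landsberg spaces follows because
$e^{2\sigma}F>0$ off the zero section. -/

noncomputable section

namespace Finsler

variable {n : ℕ}

/-! ### Calculus of partial derivatives away from the origin -/

/-- The `i`-th partial derivative of a function on `ℝⁿ`. -/
def pd (i : Fin n) (u : E n → ℝ) (y : E n) : ℝ := fderiv ℝ u y (e i)

/-- Smoothness on `ℝⁿ` minus the origin. -/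
def SmoothOff (u : E n → ℝ) : Prop := ContDiffOn ℝ ∞ u {0}ᶜ

theorem isOpen_compl_zero : IsOpen ({0}ᶜ : Set (E n)) := isOpen_compl_singleton

namespace SmoothOff

variable {u v : E n → ℝ} {y : E n}

theorem contDiffAt (hu : SmoothOff u) (hy : y ≠ 0) : ContDiffAt ℝ ∞ u y :=
  ContDiffOn.contDiffAt hu (isOpen_compl_zero.mem_nhds hy)

theorem differentiableAt (hu : SmoothOff u) (hy : y ≠ 0) : DifferentiableAt ℝ u y :=
  (hu.contDiffAt hy).differentiableAt (by simp)

theorem const (c : ℝ) : SmoothOff (fun _ : E n => c) := contDiffOn_const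

theorem coord (i : Fin n) : SmoothOff (fun y : E n => y i) :=
  (EuclideanSpace.proj (𝕜 := ℝ) i : E n →L[ℝ] ℝ).contDiff.contDiffOn

theorem add (hu : SmoothOff u) (hv : SmoothOff v) : SmoothOff (fun y => u y + v y) :=
  ContDiffOn.add hu hv

theorem sub (hu : SmoothOff u) (hv : SmoothOff v) : SmoothOff (fun y => u y - v y) :=
  ContDiffOn.sub hu hv

theorem mul (hu : SmoothOff u) (hv : SmoothOff v) : SmoothOff (fun y => u y * v y) :=
  ContDiffOn.mul hu hv

theorem sum {ι : Type*} {s : Finset ι} {u : ι → E n → ℝ} (hu : ∀ i ∈ s, SmoothOff (u i)) :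
    SmoothOff (fun y => ∑ i ∈ s, u i y) :=
  ContDiffOn.sum hu

theorem pd (hu : SmoothOff u) (i : Fin n) : SmoothOff (pd i u) :=
  (ContDiffOn.fderiv_of_isOpen (m := ∞) hu isOpen_compl_zero (by simp)).clm_apply contDiffOn_const

end SmoothOff

section Rules

variable {u v : E n → ℝ} {y : E n}

/-- The complement of the origin is open, so any identity valid for all `y ≠ 0` may be
differentiated; the tensor identities below are obtained this way. -/
theorem pd_congr (h : ∀ y, y ≠ 0 → u y = v y) (i : Fin n) (hy : y ≠ 0) : pd i u y = pd i v y := by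
  have : u =ᶠ[nhds y] v := Filter.eventually_of_mem (isOpen_compl_zero.mem_nhds hy) h
  simp [pd, this.fderiv_eq]

theorem pd_const (c : ℝ) (i : Fin n) : pd i (fun _ : E n => c) y = 0 := by
  simp [pd]

theorem pd_coord (i j : Fin n) : pd i (fun y : E n => y j) y = if j = i then 1 else 0 := by
  have := (EuclideanSpace.proj (𝕜 := ℝ) j : E n →L[ℝ] ℝ).hasFDerivAt (x := y)
  have h : HasFDerivAt (fun y : E n => y j) (EuclideanSpace.proj (𝕜 := ℝ) j : E n →L[ℝ] ℝ) y := this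
  simp [pd, h.fderiv, e]

theorem pd_add (hu : SmoothOff u) (hv : SmoothOff v) (i : Fin n) (hy : y ≠ 0) :
    pd i (fun y => u y + v y) y = pd i u y + pd i v y := by
  simp [pd, fderiv_fun_add (hu.differentiableAt hy) (hv.differentiableAt hy)]

theorem pd_mul (hu : SmoothOff u) (hv : SmoothOff v) (i : Fin n) (hy : y ≠ 0) :
    pd i (fun y => u y * v y) y = pd i u y * v y + u y * pd i v y := by
  simp [pd, fderiv_fun_mul (hu.differentiableAt hy) (hv.differentiableAt hy)]
  ring

theorem pd_const_mul (c : ℝ) (u : E n → ℝ) (i : Fin n) (y : E n) :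
    pd i (fun y => c * u y) y = c * pd i u y := by
  have h : (fun y => c * u y) = c • u := rfl
  rw [pd, h, fderiv_const_smul_field]
  simp [pd]

theorem pd_sum {ι : Type*} {s : Finset ι} {u : ι → E n → ℝ} (hu : ∀ i ∈ s, SmoothOff (u i))
    (i : Fin n) (hy : y ≠ 0) :
    pd i (fun y => ∑ a ∈ s, u a y) y = ∑ a ∈ s, pd i (u a) y := by
  simp [pd, fderiv_fun_sum fun a ha => (hu a ha).differentiableAt hy]

theorem pd_comm (hu : SmoothOff u) (i j : Fin n) (hy : y ≠ 0) :
    pd i (pd j u) y = pd j (pd i u) y := by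
  have hd : DifferentiableAt ℝ (fderiv ℝ u) y :=
    ((hu.contDiffAt hy).fderiv_right (m := 1) (by norm_cast)).differentiableAt (by simp)
  have key : ∀ i j : Fin n, pd i (pd j u) y = fderiv ℝ (fderiv ℝ u) y (e i) (e j) := fun i j => by
    have := (hd.hasFDerivAt.clm_apply (hasFDerivAt_const (e j) y)).fderiv
    change fderiv ℝ (fun y => fderiv ℝ u y (e j)) y (e i) = _
    rw [this]; simp
  rw [key, key]
  exact ((hu.contDiffAt hy).isSymmSndFDerivAt (by
    simp only [minSmoothness_of_isRCLikeNormedField]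
    exact WithTop.coe_le_coe.mpr (le_top : (2 : ℕ∞) ≤ ⊤))) _ _

theorem fderiv_eq_sum_pd (u : E n → ℝ) (y v : E n) : fderiv ℝ u y v = ∑ i, v i * pd i u y := by
  have : v = ∑ i, v i • e i := by
    ext j; simp [e, Pi.single_apply]
  conv_lhs => rw [this]
  simp [pd]

/-- The Leibniz rule for third partial derivatives. -/
theorem pd_pd_pd_mul (hu : SmoothOff u) (hv : SmoothOff v) (j k h : Fin n) (hy : y ≠ 0) :
    pd h (pd k (pd j (fun y => u y * v y))) y =
      pd h (pd k (pd j u)) y * v y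
        + (pd k (pd j u) y * pd h v y + pd h (pd j u) y * pd k v y + pd h (pd k u) y * pd j v y)
        + (pd j u y * pd h (pd k v) y + pd k u y * pd h (pd j v) y + pd h u y * pd k (pd j v) y)
        + u y * pd h (pd k (pd j v)) y := by
  have h2 : ∀ y, y ≠ 0 → pd k (pd j (fun y => u y * v y)) y =
      pd k (pd j u) y * v y + pd j u y * pd k v y + (pd k u y * pd j v y + u y * pd k (pd j v) y) :=
    fun y hy => by
      rw [pd_congr (fun y hy => pd_mul hu hv j hy) k hy,
        pd_add ((hu.pd j).mul hv) (hu.mul (hv.pd j)) k hy, pd_mul (hu.pd j) hv k hy,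
        pd_mul hu (hv.pd j) k hy]
  rw [pd_congr h2 h hy,
    pd_add ((((hu.pd j).pd k).mul hv).add ((hu.pd j).mul (hv.pd k)))
      (((hu.pd k).mul (hv.pd j)).add (hu.mul ((hv.pd j).pd k))) h hy,
    pd_add (((hu.pd j).pd k).mul hv) ((hu.pd j).mul (hv.pd k)) h hy,
    pd_add ((hu.pd k).mul (hv.pd j)) (hu.mul ((hv.pd j).pd k)) h hy,
    pd_mul ((hu.pd j).pd k) hv h hy, pd_mul (hu.pd j) (hv.pd k) h hy,
    pd_mul (hu.pd k) (hv.pd j) h hy, pd_mul hu ((hv.pd j).pd k) h hy]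
  ring

/-- Partial derivatives of a positively 2-homogeneous function satisfy Euler's relation. -/
theorem sum_mul_pd_pd_of_homogeneous (hu : SmoothOff u)
    (hom : ∀ (c : ℝ) (y : E n), 0 < c → u (c • y) = c ^ 2 * u y) (i : Fin n) (hy : y ≠ 0) :
    ∑ j, y j * pd j (pd i u) y = pd i u y := by
  -- Differentiating `u (c • z) = c ^ 2 * u z` in `z` lowers the degree of homogeneity to one.
  have h1 : ∀ c : ℝ, 0 < c → pd i u (c • y) = c * pd i u y := fun c hc => by
    have hcy : c • y ≠ 0 := smul_ne_zero hc.ne' hy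
    have hl : HasFDerivAt (fun z : E n => c • z) (c • ContinuousLinearMap.id ℝ (E n)) y :=
      (hasFDerivAt_id y).const_smul c
    have h2 := ((hu.differentiableAt hcy).hasFDerivAt.comp y hl)
    have h3 : u ∘ (fun z : E n => c • z) = fun z => c ^ 2 * u z := funext fun z => hom c z hc
    have h4 := pd_const_mul (c ^ 2) u i y
    rw [← h3, pd, h2.fderiv] at h4
    simp only [ContinuousLinearMap.comp_apply, FunLike.coe_smul, Pi.smul_apply,
      ContinuousLinearMap.id_apply, map_smul, smul_eq_mul] at h4
    have h5 : c * pd i u (c • y) = c * (c * pd i u y) := by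
      rw [← mul_assoc, ← pow_two]; exact h4
    exact mul_left_cancel₀ hc.ne' h5
  -- The derivative at `c = 1` is computed twice, by the chain rule and from `h1`; uniqueness of
  -- derivatives gives Euler's relation.
  have h2 : HasDerivAt (fun c : ℝ => pd i u (c • y)) (fderiv ℝ (pd i u) y y) 1 := by
    have hd := ((hu.pd i).differentiableAt hy).hasFDerivAt
    have hl : HasDerivAt (fun c : ℝ => c • y) ((1 : ℝ) • y) 1 := (hasDerivAt_id (1 : ℝ)).smul_const y
    rw [one_smul] at hl
    exact HasFDerivAt.comp_hasDerivAt (1 : ℝ) (by simpa using hd) hl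
  have h3 : HasDerivAt (fun c : ℝ => pd i u (c • y)) (pd i u y) 1 := by
    have : HasDerivAt (fun c : ℝ => c * pd i u y) (1 * pd i u y) 1 :=
      (hasDerivAt_id (1 : ℝ)).mul_const _
    rw [one_mul] at this
    exact this.congr_of_eventuallyEq
      (Filter.eventually_of_mem (Ioi_mem_nhds (by norm_num : (0 : ℝ) < 1)) fun c hc => h1 c hc)
  rw [← fderiv_eq_sum_pd]
  exact h2.unique h3

end Rules

/-! ### Smoothness of the inverse of a matrix function -/

section MatrixInverse

variable {A : E n → Matrix (Fin n) (Fin n) ℝ}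

theorem smoothOff_det (hA : ∀ i j, SmoothOff fun y => A y i j) : SmoothOff fun y => (A y).det := by
  simp only [Matrix.det_apply']
  exact SmoothOff.sum fun p _ => (SmoothOff.const _).mul (contDiffOn_prod fun i _ => hA _ _)

/-- By Cramer's rule each entry is a quotient of determinants, hence of polynomials in the entries.
-/
theorem smoothOff_inv (hA : ∀ i j, SmoothOff fun y => A y i j)
    (hdet : ∀ y, y ≠ 0 → (A y).det ≠ 0) (i j : Fin n) : SmoothOff fun y => (A y)⁻¹ i j := by
  have h : ∀ y, (A y)⁻¹ i j = (A y).det⁻¹ * (A y).adjugate i j := fun y => by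
    simp [Matrix.inv_def, Ring.inverse_eq_inv']
  simp only [h, Matrix.adjugate_apply]
  refine SmoothOff.mul (ContDiffOn.inv (smoothOff_det hA) hdet) (smoothOff_det fun a b => ?_)
  by_cases hab : a = j
  · subst hab
    simpa using SmoothOff.const _
  · simpa [Matrix.updateRow_ne hab] using hA a b

end MatrixInverse

/-! ### Metric and Cartan tensors on a coordinate domain -/

/-- A Finsler function on a coordinate domain `U`. -/
structure IsLocalFinsler (U : Set (E n)) (F : E n → E n → ℝ) : Prop where
  isOpen : IsOpen U
  pos : ∀ x ∈ U, ∀ y, y ≠ 0 → 0 < F x y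
  homogeneous : ∀ x ∈ U, ∀ (c : ℝ) (y : E n), 0 < c → F x (c • y) = c * F x y
  smooth : ContDiffOn ℝ ∞ (fun p : E n × E n => F p.1 p.2) (U ×ˢ {0}ᶜ)
  posDef : ∀ x ∈ U, ∀ y, y ≠ 0 → (metricMatrix F x y).PosDef

namespace IsLocalFinsler

variable {U : Set (E n)} {F : E n → E n → ℝ} {x y : E n}

theorem smoothOff (hF : IsLocalFinsler U F) (hx : x ∈ U) : SmoothOff (F x) :=
  hF.smooth.comp (contDiff_const.prodMk contDiff_id).contDiffOn fun _ hy => ⟨hx, hy⟩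

theorem smoothOff_sq (hF : IsLocalFinsler U F) (hx : x ∈ U) : SmoothOff (sq F x) :=
  ContDiffOn.pow (hF.smoothOff hx) 2

theorem smoothOff_metric (hF : IsLocalFinsler U F) (hx : x ∈ U) (i j : Fin n) :
    SmoothOff (metric F i j x) :=
  (SmoothOff.const _).mul (((hF.smoothOff_sq hx).pd j).pd i)

theorem smoothOff_cartan (hF : IsLocalFinsler U F) (hx : x ∈ U) (i j k : Fin n) :
    SmoothOff (cartan F i j k x) :=
  (SmoothOff.const _).mul ((hF.smoothOff_metric hx i j).pd k)

theorem det_ne_zero (hF : IsLocalFinsler U F) (hx : x ∈ U) (hy : y ≠ 0) :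
    (metricMatrix F x y).det ≠ 0 :=
  (hF.posDef x hx y hy).det_pos.ne'

theorem smoothOff_invMetric (hF : IsLocalFinsler U F) (hx : x ∈ U) (i j : Fin n) :
    SmoothOff (invMetric F i j x) :=
  smoothOff_inv (hF.smoothOff_metric hx) (fun _ hy => hF.det_ne_zero hx hy) i j

theorem metric_symm (hF : IsLocalFinsler U F) (hx : x ∈ U) (hy : y ≠ 0) (i j : Fin n) :
    metric F i j x y = metric F j i x y :=
  congrArg (1 / 2 * ·) (pd_comm (hF.smoothOff_sq hx) i j hy)

theorem invMetric_symm (hF : IsLocalFinsler U F) (hx : x ∈ U) (hy : y ≠ 0) (i j : Fin n) :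
    invMetric F i j x y = invMetric F j i x y := by
  have h : (metricMatrix F x y).transpose = metricMatrix F x y :=
    Matrix.ext fun a b => hF.metric_symm hx hy b a
  have h2 := congrFun (congrFun (Matrix.transpose_nonsing_inv (metricMatrix F x y)) j) i
  rw [h] at h2
  exact h2

theorem sum_metric_mul_invMetric (hF : IsLocalFinsler U F) (hx : x ∈ U) (hy : y ≠ 0)
    (i j : Fin n) : ∑ k, metric F i k x y * invMetric F k j x y = if i = j then 1 else 0 := by
  have h := Matrix.mul_nonsing_inv (metricMatrix F x y)
    (isUnit_iff_ne_zero.mpr (hF.det_ne_zero hx hy))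
  have h2 := congrFun (congrFun h i) j
  rwa [Matrix.mul_apply, Matrix.one_apply] at h2

theorem sum_invMetric_mul_metric (hF : IsLocalFinsler U F) (hx : x ∈ U) (hy : y ≠ 0)
    (i j : Fin n) : ∑ k, invMetric F i k x y * metric F k j x y = if i = j then 1 else 0 := by
  have h := Matrix.nonsing_inv_mul (metricMatrix F x y)
    (isUnit_iff_ne_zero.mpr (hF.det_ne_zero hx hy))
  have h2 := congrFun (congrFun h i) j
  rwa [Matrix.mul_apply, Matrix.one_apply] at h2

theorem pd_metric (i j k : Fin n) : pd k (metric F i j x) y = 2 * cartan F i j k x y := by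
  simp only [cartan, dy, pd]; ring

theorem cartan_swap_left (hF : IsLocalFinsler U F) (hx : x ∈ U) (hy : y ≠ 0) (i j k : Fin n) :
    cartan F i j k x y = cartan F j i k x y :=
  congrArg (1 / 2 * ·) (pd_congr (fun _ hy => hF.metric_symm hx hy i j) k hy)

/-- The Cartan tensor is a quarter of the third derivative of $F^2$; with `cartan_swap_left` this
gives total symmetry. -/
theorem cartan_swap_right (hF : IsLocalFinsler U F) (hx : x ∈ U) (hy : y ≠ 0) (i j k : Fin n) :
    cartan F i j k x y = cartan F i k j x y := by
  rw [hF.cartan_swap_left hx hy i j, hF.cartan_swap_left hx hy i k]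
  change 1 / 2 * pd k (fun y => 1 / 2 * pd j (pd i (sq F x)) y) y =
    1 / 2 * pd j (fun y => 1 / 2 * pd k (pd i (sq F x)) y) y
  rw [pd_const_mul, pd_const_mul, pd_comm ((hF.smoothOff_sq hx).pd i) k j hy]

theorem dCartan_swap_left (hF : IsLocalFinsler U F) (hx : x ∈ U) (hy : y ≠ 0)
    (i j k h : Fin n) : dCartan F i j k h x y = dCartan F j i k h x y :=
  pd_congr (fun _ hy => hF.cartan_swap_left hx hy i j k) h hy

theorem dCartan_swap_mid (hF : IsLocalFinsler U F) (hx : x ∈ U) (hy : y ≠ 0)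
    (i j k h : Fin n) : dCartan F i j k h x y = dCartan F i k j h x y :=
  pd_congr (fun _ hy => hF.cartan_swap_right hx hy i j k) h hy

theorem dCartan_swap_right (hF : IsLocalFinsler U F) (hx : x ∈ U) (hy : y ≠ 0)
    (i j k h : Fin n) : dCartan F i j k h x y = dCartan F i j h k x y := by
  change pd h (fun y => 1 / 2 * pd k (metric F i j x) y) y =
    pd k (fun y => 1 / 2 * pd h (metric F i j x) y) y
  rw [pd_const_mul, pd_const_mul, pd_comm (hF.smoothOff_metric hx i j) h k hy]

theorem pd_sq (hF : IsLocalFinsler U F) (hx : x ∈ U) (hy : y ≠ 0) (i : Fin n) :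
    pd i (sq F x) y = 2 * (F x y * ell F i x y) := by
  have h : sq F x = fun y => F x y * F x y := funext fun y => pow_two _
  rw [h, pd_mul (hF.smoothOff hx) (hF.smoothOff hx) i hy]
  change pd i (F x) y * F x y + F x y * pd i (F x) y = 2 * (F x y * pd i (F x) y)
  ring

theorem smoothOff_ell (hF : IsLocalFinsler U F) (hx : x ∈ U) (i : Fin n) :
    SmoothOff (ell F i x) := (hF.smoothOff hx).pd i

/-! ### Contractions of $F\ell_i$ with derivatives of the inverse metric -/

/-- `∂̇_j (F ℓ_i) = g_{ij}`. -/
theorem pd_mul_ell (hF : IsLocalFinsler U F) (hx : x ∈ U) (hy : y ≠ 0) (i j : Fin n) :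
    pd j (fun y => F x y * ell F i x y) y = metric F i j x y := by
  rw [hF.metric_symm hx hy]
  change _ = 1 / 2 * pd j (pd i (sq F x)) y
  rw [pd_congr (fun _ hy => hF.pd_sq hx hy i) j hy, pd_const_mul]
  ring

/-- `g^{ij} ∂̇_j F² = 2 yⁱ`. -/
theorem sum_invMetric_mul_pd_sq (hF : IsLocalFinsler U F) (hx : x ∈ U) (hy : y ≠ 0)
    (i : Fin n) : ∑ h, invMetric F i h x y * pd h (sq F x) y = 2 * y i := by
  -- Euler's relation for the 1-homogeneous function $\dot\partial_h F^2$.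
  have hh : ∀ h, pd h (sq F x) y = 2 * ∑ j, metric F h j x y * y j := fun h => by
    rw [← sum_mul_pd_pd_of_homogeneous (hF.smoothOff_sq hx) (fun c z hc => by
      simp only [sq, hF.homogeneous x hx c z hc]; ring) h hy, Finset.mul_sum]
    refine Finset.sum_congr rfl fun j _ => ?_
    rw [hF.metric_symm hx hy]
    change _ = 2 * ((1 / 2 * pd j (pd h (sq F x)) y) * y j)
    ring
  calc ∑ h, invMetric F i h x y * pd h (sq F x) y
      = 2 * ∑ h, ∑ j, invMetric F i h x y * metric F h j x y * y j := by
        simp only [hh, Finset.mul_sum]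
        exact Finset.sum_congr rfl fun _ _ => Finset.sum_congr rfl fun _ _ => by ring
    _ = 2 * y i := by
        rw [Finset.sum_comm]
        simp only [← Finset.sum_mul, hF.sum_invMetric_mul_metric hx hy]
        simp

/-- `F ℓ_i g^{ir} = y^r`. -/
theorem sum_mul_ell_mul_invMetric (hF : IsLocalFinsler U F) (hx : x ∈ U) (hy : y ≠ 0)
    (r : Fin n) : ∑ i, F x y * ell F i x y * invMetric F i r x y = y r := by
  have h := hF.sum_invMetric_mul_pd_sq hx hy r
  have h2 : ∑ h, invMetric F r h x y * pd h (sq F x) y =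
      2 * ∑ i, F x y * ell F i x y * invMetric F i r x y := by
    rw [Finset.mul_sum]
    refine Finset.sum_congr rfl fun i _ => ?_
    rw [hF.pd_sq hx hy, hF.invMetric_symm hx hy r i]; ring
  linarith

/-- `g_{ai} ∂̇_k g^{ir} = -2 C_{aik} g^{ir}`. -/
theorem sum_metric_mul_pd_invMetric (hF : IsLocalFinsler U F) (hx : x ∈ U) (hy : y ≠ 0)
    (a r k : Fin n) : ∑ i, metric F a i x y * pd k (invMetric F i r x) y =
      -2 * ∑ i, cartan F a i k x y * invMetric F i r x y := by
  have h1 : pd k (fun y => ∑ i, metric F a i x y * invMetric F i r x y) y = 0 := by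
    rw [pd_congr (fun _ hy => hF.sum_metric_mul_invMetric hx hy a r) k hy, pd_const]
  rw [pd_sum (fun i _ => (hF.smoothOff_metric hx a i).mul (hF.smoothOff_invMetric hx i r)) k hy]
    at h1
  have h2 : ∀ i, pd k (fun y => metric F a i x y * invMetric F i r x y) y =
      2 * (cartan F a i k x y * invMetric F i r x y)
        + metric F a i x y * pd k (invMetric F i r x) y := fun i => by
    rw [pd_mul (hF.smoothOff_metric hx a i) (hF.smoothOff_invMetric hx i r) k hy, pd_metric]
    ring
  simp only [h2, Finset.sum_add_distrib, ← Finset.mul_sum] at h1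
  linarith

/-- `∂̇_h g^{sr} = -2 g^{rl} C^s_{lh}`. -/
theorem sum_invMetric_mul_cartanUp (hF : IsLocalFinsler U F) (hx : x ∈ U) (hy : y ≠ 0)
    (r s h : Fin n) : ∑ l, invMetric F r l x y * cartanUp F s l h x y =
      -(1 / 2) * pd h (invMetric F s r x) y := by
  -- The identity matrix is inserted as $g^{sm}g_{mi}$, so that the inner sum is the derivative
  -- formula already known.
  have h1 : pd h (invMetric F s r x) y = ∑ m, invMetric F s m x y *
      ∑ i, metric F m i x y * pd h (invMetric F i r x) y := by
    simp only [Finset.mul_sum, ← mul_assoc]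
    rw [Finset.sum_comm]
    simp only [← Finset.sum_mul, hF.sum_invMetric_mul_metric hx hy]
    simp
  simp only [hF.sum_metric_mul_pd_invMetric hx hy] at h1
  rw [h1]
  simp only [cartanUp, Finset.mul_sum]
  rw [Finset.sum_comm]
  refine Finset.sum_congr rfl fun m _ => Finset.sum_congr rfl fun l _ => ?_
  rw [hF.invMetric_symm hx hy m s, hF.invMetric_symm hx hy r l,
    hF.cartan_swap_right hx hy l h m, hF.cartan_swap_left hx hy l m h]
  ring

/-- `F ℓ_i ∂̇_j g^{ir} = 0`. -/
theorem sum_mul_ell_mul_pd_invMetric (hF : IsLocalFinsler U F) (hx : x ∈ U) (hy : y ≠ 0)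
    (r j : Fin n) : ∑ i, F x y * ell F i x y * pd j (invMetric F i r x) y = 0 := by
  have hw := fun i => (hF.smoothOff hx).mul (hF.smoothOff_ell hx i)
  -- Differentiating $w_i g^{ir} = y^r$ gives $\delta_j^r$ on the right, which cancels
  -- $g_{ij}g^{ir}$ on the left.
  have h1 := pd_congr (fun _ hy => hF.sum_mul_ell_mul_invMetric hx hy r) j hy
  rw [pd_coord, pd_sum (fun i _ => (hw i).mul (hF.smoothOff_invMetric hx i r)) j hy] at h1
  simp only [pd_mul (hw _) (hF.smoothOff_invMetric hx _ r) j hy, hF.pd_mul_ell hx hy,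
    Finset.sum_add_distrib] at h1
  simp only [hF.metric_symm hx hy _ j, hF.sum_metric_mul_invMetric hx hy] at h1
  simp only [eq_comm (a := j)] at h1
  linarith

/-- `F ℓ_i ∂̇_k ∂̇_j g^{ir} = 2 C_{kij} g^{ir}`. -/
theorem sum_mul_ell_mul_pd_pd_invMetric (hF : IsLocalFinsler U F) (hx : x ∈ U) (hy : y ≠ 0)
    (r j k : Fin n) : ∑ i, F x y * ell F i x y * pd k (pd j (invMetric F i r x)) y =
      2 * ∑ i, cartan F k i j x y * invMetric F i r x y := by
  have hw := fun i => (hF.smoothOff hx).mul (hF.smoothOff_ell hx i)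
  have hH := fun i => (hF.smoothOff_invMetric hx i r).pd j
  have h1 := pd_congr (fun _ hy => hF.sum_mul_ell_mul_pd_invMetric hx hy r j) k hy
  rw [pd_const, pd_sum (fun i _ => (hw i).mul (hH i)) k hy] at h1
  simp only [pd_mul (hw _) (hH _) k hy, hF.pd_mul_ell hx hy, Finset.sum_add_distrib] at h1
  simp only [hF.metric_symm hx hy _ k, hF.sum_metric_mul_pd_invMetric hx hy] at h1
  linarith

/-- `F ℓ_i ∂̇_h ∂̇_k ∂̇_j g^{ir}` in terms of the Cartan tensor. -/
theorem sum_mul_ell_mul_pd_pd_pd_invMetric (hF : IsLocalFinsler U F) (hx : x ∈ U) (hy : y ≠ 0)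
    (r j k h : Fin n) :
    ∑ i, F x y * ell F i x y * pd h (pd k (pd j (invMetric F i r x))) y =
      4 * ∑ i, dCartan F i j k h x y * invMetric F i r x y
        + 2 * (∑ i, cartan F i j k x y * pd h (invMetric F i r x) y
          + ∑ i, cartan F i k h x y * pd j (invMetric F i r x) y
          + ∑ i, cartan F i j h x y * pd k (invMetric F i r x) y) := by
  have hw := fun i => (hF.smoothOff hx).mul (hF.smoothOff_ell hx i)
  have hH := fun i => hF.smoothOff_invMetric hx i r
  -- Differentiating the second-order contraction leaves the extra term
  -- $g_{ih}\dot\partial_k\dot\partial_j g^{ir}$.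
  have h1 := pd_congr (fun _ hy => hF.sum_mul_ell_mul_pd_pd_invMetric hx hy r j k) h hy
  rw [pd_const_mul, pd_sum (fun i _ => (hw i).mul (((hH i).pd j).pd k)) h hy,
    pd_sum (fun i _ => (hF.smoothOff_cartan hx k i j).mul (hH i)) h hy] at h1
  simp only [pd_mul (hw _) (((hH _).pd j).pd k) h hy,
    pd_mul (hF.smoothOff_cartan hx k _ j) (hH _) h hy, hF.pd_mul_ell hx hy,
    Finset.sum_add_distrib] at h1
  -- This evaluates the extra term. It and the right side of `h1` each contribute $2C_{ijkh}g^{ir}$,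
  -- whence the coefficient 4.
  have h2 := pd_congr (fun _ hy => hF.sum_metric_mul_pd_invMetric hx hy h r j) k hy
  rw [pd_const_mul, pd_sum (fun i _ => (hF.smoothOff_metric hx h i).mul ((hH i).pd j)) k hy,
    pd_sum (fun i _ => (hF.smoothOff_cartan hx h i j).mul (hH i)) k hy] at h2
  simp only [pd_mul (hF.smoothOff_metric hx h _) ((hH _).pd j) k hy,
    pd_mul (hF.smoothOff_cartan hx h _ j) (hH _) k hy, pd_metric,
    Finset.sum_add_distrib, mul_assoc, ← Finset.mul_sum] at h2
  have d1 : ∀ i, pd h (cartan F k i j x) y = dCartan F i j k h x y := fun i => by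
    change dCartan F k i j h x y = _
    rw [hF.dCartan_swap_left hx hy, hF.dCartan_swap_mid hx hy]
  have d2 : ∀ i, pd k (cartan F h i j x) y = dCartan F i j k h x y := fun i => by
    change dCartan F h i j k x y = _
    rw [hF.dCartan_swap_left hx hy, hF.dCartan_swap_mid hx hy, hF.dCartan_swap_right hx hy]
  have c1 : ∀ a b i, cartan F a i b x y = cartan F i b a x y := fun a b i => by
    rw [hF.cartan_swap_left hx hy, hF.cartan_swap_right hx hy]
  simp only [hF.metric_symm hx hy _ h, d1, c1 k j] at h1
  simp only [d2, c1 h] at h2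
  linarith

/-! ### The T-tensor as a contracted third derivative -/

/-- Both sides are $C_{sal}g^{sm}C_{mbc}$. The form on the right has `l`, the index to be raised in
$T^r_{jkh}$, on the `cartanUp` factor. -/
theorem sum_cartan_mul_cartanUp_comm (hF : IsLocalFinsler U F) (hx : x ∈ U) (hy : y ≠ 0)
    (a b c l : Fin n) : ∑ s, cartan F s a l x y * cartanUp F s b c x y =
      ∑ s, cartan F s b c x y * cartanUp F s l a x y := by
  simp only [cartanUp, Finset.mul_sum]
  rw [Finset.sum_comm]
  refine Finset.sum_congr rfl fun m _ => Finset.sum_congr rfl fun s _ => ?_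
  rw [hF.invMetric_symm hx hy m s, hF.cartan_swap_right hx hy b c m,
    hF.cartan_swap_left hx hy b m c, hF.cartan_swap_right hx hy s a l,
    hF.cartan_swap_left hx hy s l a, hF.cartan_swap_right hx hy l s a]
  ring

theorem pd_pd_pd_sq (j k h : Fin n) : pd h (pd k (pd j (sq F x))) y = 4 * cartan F k j h x y := by
  have := pd_metric (F := F) (x := x) (y := y) k j h
  change pd h (fun y => 1 / 2 * pd k (pd j (sq F x)) y) y = _ at this
  rw [pd_const_mul] at this
  linarith

/-- `F ℓ_i ∂̇_h ∂̇_k ∂̇_j (F² g^{ir}) = 4 F T^r_{jkh}`. -/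
theorem sum_mul_ell_mul_pd_pd_pd (hF : IsLocalFinsler U F) (hx : x ∈ U) (hy : y ≠ 0)
    (r j k h : Fin n) :
    ∑ i, F x y * ell F i x y *
        pd h (pd k (pd j (fun y => sq F x y * invMetric F i r x y))) y =
      4 * (F x y * tTensorUp F r j k h x y) := by
  set w : Fin n → ℝ := fun i => F x y * ell F i x y with hw
  have c1 : ∀ a b i, cartan F a i b x y = cartan F i b a x y := fun a b i => by
    rw [hF.cartan_swap_left hx hy, hF.cartan_swap_right hx hy]
  -- The Leibniz expansion, grouped by the number of derivatives falling on $g^{ir}$; the group with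
  -- exactly one vanishes, as $w_i\dot\partial_j g^{ir}=0$.
  have hL : ∑ i, w i * pd h (pd k (pd j (fun y => sq F x y * invMetric F i r x y))) y =
      4 * cartan F k j h x y * ∑ i, w i * invMetric F i r x y
      + (pd k (pd j (sq F x)) y * ∑ i, w i * pd h (invMetric F i r x) y
        + pd h (pd j (sq F x)) y * ∑ i, w i * pd k (invMetric F i r x) y
        + pd h (pd k (sq F x)) y * ∑ i, w i * pd j (invMetric F i r x) y)
      + (2 * w j * ∑ i, w i * pd h (pd k (invMetric F i r x)) y
        + 2 * w k * ∑ i, w i * pd h (pd j (invMetric F i r x)) y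
        + 2 * w h * ∑ i, w i * pd k (pd j (invMetric F i r x)) y)
      + sq F x y * ∑ i, w i * pd h (pd k (pd j (invMetric F i r x))) y := by
    simp only [Finset.mul_sum, ← Finset.sum_add_distrib]
    refine Finset.sum_congr rfl fun i _ => ?_
    rw [pd_pd_pd_mul (hF.smoothOff_sq hx) (hF.smoothOff_invMetric hx i r) j k h hy,
      pd_pd_pd_sq]
    simp only [hF.pd_sq hx hy]
    ring
  -- The quadratic Cartan terms of the T-tensor become $C\,\dot\partial g^{-1}$ terms, the shape in
  -- which they occur in the third-order contraction.
  have hq : ∀ a b c, ∑ l, invMetric F r l x y * ∑ s, cartan F s a b x y * cartanUp F s l c x y =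
      -(1 / 2) * ∑ s, cartan F s a b x y * pd c (invMetric F s r x) y := fun a b c => by
    simp only [Finset.mul_sum]
    rw [Finset.sum_comm]
    refine Finset.sum_congr rfl fun s _ => ?_
    have := hF.sum_invMetric_mul_cartanUp hx hy r s c
    calc _ = cartan F s a b x y * ∑ l, invMetric F r l x y * cartanUp F s l c x y := by
          rw [Finset.mul_sum]; exact Finset.sum_congr rfl fun _ _ => by ring
      _ = _ := by rw [this]; ring
  have hT : tTensorUp F r j k h x y =
      F x y * ∑ l, invMetric F r l x y * dCartan F l j k h x y
      - F x y * (∑ l, invMetric F r l x y * ∑ s, cartan F s j k x y * cartanUp F s l h x y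
        + ∑ l, invMetric F r l x y * ∑ s, cartan F s j h x y * cartanUp F s l k x y
        + ∑ l, invMetric F r l x y * ∑ s, cartan F s k h x y * cartanUp F s l j x y)
      + (∑ l, invMetric F r l x y * cartan F l j k x y) * ell F h x y
      + (∑ l, invMetric F r l x y * cartan F l j h x y) * ell F k x y
      + (∑ l, invMetric F r l x y * cartan F l k h x y) * ell F j x y
      + cartan F j k h x y * ∑ l, invMetric F r l x y * ell F l x y := by
    simp only [tTensorUp, tTensor, Finset.sum_add_distrib,
      hF.sum_cartan_mul_cartanUp_comm hx hy k j h, hF.sum_cartan_mul_cartanUp_comm hx hy j k h]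
    rw [← Finset.sum_add_distrib, ← Finset.sum_add_distrib, Finset.mul_sum, Finset.mul_sum,
      Finset.mul_sum, Finset.sum_mul, Finset.sum_mul, Finset.sum_mul]
    simp only [← Finset.sum_add_distrib, ← Finset.sum_sub_distrib]
    exact Finset.sum_congr rfl fun l _ => by simp only [Finset.sum_add_distrib]; ring
  have e1 : ∑ i, w i * invMetric F i r x y = F x y * ∑ l, invMetric F r l x y * ell F l x y := by
    rw [Finset.mul_sum]
    exact Finset.sum_congr rfl fun l _ => by rw [hF.invMetric_symm hx hy l r, hw]; ring
  have e2 : ∀ a b, ∑ i, cartan F a i b x y * invMetric F i r x y =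
      ∑ l, invMetric F r l x y * cartan F l b a x y := fun a b =>
    Finset.sum_congr rfl fun l _ => by rw [hF.invMetric_symm hx hy l r, c1]; ring
  have e3 : ∑ i, dCartan F i j k h x y * invMetric F i r x y =
      ∑ l, invMetric F r l x y * dCartan F l j k h x y :=
    Finset.sum_congr rfl fun l _ => by rw [hF.invMetric_symm hx hy l r]; ring
  rw [hL, hF.sum_mul_ell_mul_pd_pd_pd_invMetric hx hy, hF.sum_mul_ell_mul_pd_invMetric hx hy,
    hF.sum_mul_ell_mul_pd_invMetric hx hy, hF.sum_mul_ell_mul_pd_invMetric hx hy,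
    hF.sum_mul_ell_mul_pd_pd_invMetric hx hy, hF.sum_mul_ell_mul_pd_pd_invMetric hx hy,
    hF.sum_mul_ell_mul_pd_pd_invMetric hx hy, e1, e2, e2, e2, e3, hT, hq, hq, hq,
    hF.cartan_swap_left hx hy k j h]
  simp only [hw, sq]
  ring

end IsLocalFinsler

/-! ### Joint smoothness in position and direction -/

section JointSmoothness

variable {U : Set (E n)} {f : E n → E n → ℝ}

theorem smoothOff_of_joint (hf : ContDiffOn ℝ ∞ (fun p : E n × E n => f p.1 p.2) (U ×ˢ {0}ᶜ))
    {x : E n} (hx : x ∈ U) : SmoothOff (f x) :=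
  ContDiffOn.comp (t := U ×ˢ {0}ᶜ) (g := fun p : E n × E n => f p.1 p.2) hf
    (contDiff_const.prodMk contDiff_id).contDiffOn fun _ hy => ⟨hx, hy⟩

theorem differentiableAt_of_joint (hU : IsOpen U)
    (hf : ContDiffOn ℝ ∞ (fun p : E n × E n => f p.1 p.2) (U ×ˢ {0}ᶜ))
    {x y : E n} (hx : x ∈ U) (hy : y ≠ 0) : DifferentiableAt ℝ (fun x => f x y) x := by
  have hxy : ((x, y) : E n × E n) ∈ U ×ˢ ({0}ᶜ : Set (E n)) := ⟨hx, hy⟩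
  have h := (hf.contDiffAt ((hU.prod isOpen_compl_zero).mem_nhds hxy)).differentiableAt (by simp)
  exact DifferentiableAt.comp (f := fun x : E n => (x, y)) x h
    (hasFDerivAt_prodMk_left (𝕜 := ℝ) x y).differentiableAt

/-- The partial derivative is the joint derivative applied to `(e i, 0)`. Joint smoothness is needed
because the spray mixes $x$- and $y$-derivatives. -/
theorem joint_dx (hU : IsOpen U)
    (hf : ContDiffOn ℝ ∞ (fun p : E n × E n => f p.1 p.2) (U ×ˢ {0}ᶜ)) (i : Fin n) :
    ContDiffOn ℝ ∞ (fun p : E n × E n => dx i f p.1 p.2) (U ×ˢ {0}ᶜ) := by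
  have hO := hU.prod (isOpen_compl_zero (n := n))
  refine ((hf.fderiv_of_isOpen (m := ∞) hO (by simp)).clm_apply
    (contDiffOn_const (c := ((e i, 0) : E n × E n)))).congr fun p hp => ?_
  have h := ((hf.contDiffAt (hO.mem_nhds hp)).differentiableAt (by simp)).hasFDerivAt
  have h2 := HasFDerivAt.comp (f := fun x : E n => (x, p.2)) p.1 h
    (hasFDerivAt_prodMk_left (𝕜 := ℝ) p.1 p.2)
  have h3 : dx i f p.1 p.2 = _ := congrArg (· (e i)) h2.fderiv
  rw [h3]
  simp

theorem joint_dy (hU : IsOpen U)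
    (hf : ContDiffOn ℝ ∞ (fun p : E n × E n => f p.1 p.2) (U ×ˢ {0}ᶜ)) (i : Fin n) :
    ContDiffOn ℝ ∞ (fun p : E n × E n => dy i f p.1 p.2) (U ×ˢ {0}ᶜ) := by
  have hO := hU.prod (isOpen_compl_zero (n := n))
  refine ((hf.fderiv_of_isOpen (m := ∞) hO (by simp)).clm_apply
    (contDiffOn_const (c := ((0, e i) : E n × E n)))).congr fun p hp => ?_
  have h := ((hf.contDiffAt (hO.mem_nhds hp)).differentiableAt (by simp)).hasFDerivAt
  have h2 := HasFDerivAt.comp (f := fun y : E n => (p.1, y)) p.2 h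
    (hasFDerivAt_prodMk_right (𝕜 := ℝ) p.1 p.2)
  have h3 : dy i f p.1 p.2 = _ := congrArg (· (e i)) h2.fderiv
  rw [h3]
  simp

end JointSmoothness

/-! ### Third derivatives of sums and of quadratic polynomials -/

section ThirdDerivatives

variable {u v : E n → ℝ} {y : E n}

theorem pd_pd_pd_congr (huv : ∀ y, y ≠ 0 → u y = v y) (j k h : Fin n) (hy : y ≠ 0) :
    pd h (pd k (pd j u)) y = pd h (pd k (pd j v)) y :=
  pd_congr (fun _ hy => pd_congr (fun _ hy => pd_congr huv j hy) k hy) h hy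

theorem pd_pd_pd_add (hu : SmoothOff u) (hv : SmoothOff v) (j k h : Fin n) (hy : y ≠ 0) :
    pd h (pd k (pd j (fun y => u y + v y))) y =
      pd h (pd k (pd j u)) y + pd h (pd k (pd j v)) y := by
  rw [pd_congr (fun _ hy => (pd_congr (fun _ hy => pd_add hu hv j hy) k hy).trans
    (pd_add (hu.pd j) (hv.pd j) k hy)) h hy, pd_add ((hu.pd j).pd k) ((hv.pd j).pd k) h hy]

theorem pd_pd_pd_const_mul (c : ℝ) (u : E n → ℝ) (j k h : Fin n) (y : E n) :
    pd h (pd k (pd j (fun y => c * u y))) y = c * pd h (pd k (pd j u)) y := by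
  have : ∀ (i : Fin n) (u : E n → ℝ), pd i (fun y => c * u y) = fun y => c * pd i u y :=
    fun i u => funext fun y => pd_const_mul c u i y
  simp only [this]

theorem pd_pd_pd_sum {ι : Type*} {s : Finset ι} {u : ι → E n → ℝ} (hu : ∀ i ∈ s, SmoothOff (u i))
    (j k h : Fin n) (hy : y ≠ 0) :
    pd h (pd k (pd j (fun y => ∑ a ∈ s, u a y))) y = ∑ a ∈ s, pd h (pd k (pd j (u a))) y := by
  rw [pd_congr (fun _ hy => (pd_congr (fun _ hy => pd_sum hu j hy) k hy).trans
    (pd_sum (fun a ha => (hu a ha).pd j) k hy)) h hy,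
    pd_sum (fun a ha => ((hu a ha).pd j).pd k) h hy]

theorem pd_pd_linear_eq_zero (c : Fin n → ℝ) (j k : Fin n) (hy : y ≠ 0) :
    pd k (pd j (fun y => ∑ r, c r * y r)) y = 0 := by
  have : ∀ y, y ≠ 0 → pd j (fun y : E n => ∑ r, c r * y r) y = c j := fun y hy => by
    rw [pd_sum (fun r _ => (SmoothOff.const (c r)).mul (SmoothOff.coord r)) j hy]
    simp [pd_const_mul, pd_coord]
  rw [pd_congr this k hy, pd_const]

theorem pd_pd_coord (i j k : Fin n) : pd k (pd j (fun y : E n => y i)) y = 0 := by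
  have : pd j (fun y : E n => y i) = fun _ => if i = j then 1 else 0 :=
    funext fun _ => pd_coord j i
  rw [this, pd_const]

/-- Quadratic polynomials have vanishing third derivatives. -/
theorem pd_pd_pd_linear_mul_coord (c : Fin n → ℝ) (i j k h : Fin n) (hy : y ≠ 0) :
    pd h (pd k (pd j (fun y => (∑ r, c r * y r) * y i))) y = 0 := by
  have hS : SmoothOff (fun y : E n => ∑ r, c r * y r) :=
    SmoothOff.sum fun r _ => (SmoothOff.const (c r)).mul (SmoothOff.coord r)
  have h3 : pd h (pd k (pd j (fun y => ∑ r, c r * y r))) y = 0 := by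
    rw [pd_congr (fun _ hy => pd_pd_linear_eq_zero c j k hy) h hy, pd_const]
  have h4 : pd h (pd k (pd j (fun y : E n => y i))) y = 0 := by
    rw [pd_congr (fun _ _ => pd_pd_coord i j k) h hy, pd_const]
  rw [pd_pd_pd_mul hS (SmoothOff.coord i) j k h hy, h3, h4]
  simp only [pd_pd_linear_eq_zero c _ _ hy, pd_pd_coord]
  ring

end ThirdDerivatives

/-! ### The conformal change in local coordinates -/

section Conformal

variable {U : Set (E n)} {F : E n → E n → ℝ} {s : E n → ℝ} {x y : E n}

/-- The conformal change of `F` by `s` in local coordinates. -/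
def localConformal (s : E n → ℝ) (F : E n → E n → ℝ) (x y : E n) : ℝ := Real.exp (s x) * F x y

theorem sq_localConformal : sq (localConformal s F) = fun x y => Real.exp (2 * s x) * sq F x y := by
  funext x y
  rw [two_mul, Real.exp_add]
  simp only [sq, localConformal]
  ring

theorem ell_localConformal (i : Fin n) :
    ell (localConformal s F) i x y = Real.exp (s x) * ell F i x y :=
  pd_const_mul (Real.exp (s x)) (F x) i y

theorem dy_sq_localConformal (h : Fin n) :
    dy h (sq (localConformal s F)) = fun x y => Real.exp (2 * s x) * dy h (sq F) x y := by
  funext x y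
  rw [sq_localConformal]
  exact pd_const_mul (Real.exp (2 * s x)) (sq F x) h y

theorem metricMatrix_localConformal :
    metricMatrix (localConformal s F) x y = Real.exp (2 * s x) • metricMatrix F x y := by
  ext i j
  change 1 / 2 * dy i (dy j (sq (localConformal s F))) x y =
    Real.exp (2 * s x) * (1 / 2 * dy i (dy j (sq F)) x y)
  rw [dy_sq_localConformal]
  have : dy i (fun x y => Real.exp (2 * s x) * dy j (sq F) x y) x y = _ :=
    pd_const_mul (Real.exp (2 * s x)) (dy j (sq F) x) i y
  rw [this]
  change 1 / 2 * (_ * dy i (dy j (sq F)) x y) = _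
  ring

theorem posDef_localConformal (h : (metricMatrix F x y).PosDef) :
    (metricMatrix (localConformal s F) x y).PosDef := by
  rw [metricMatrix_localConformal]
  exact h.smul (Real.exp_pos _)

theorem invMetric_localConformal (hdet : (metricMatrix F x y).det ≠ 0) (i j : Fin n) :
    invMetric (localConformal s F) i j x y = (Real.exp (2 * s x))⁻¹ * invMetric F i j x y := by
  have := Matrix.inv_smul' (A := metricMatrix F x y)
    (Units.mk0 (Real.exp (2 * s x)) (Real.exp_pos _).ne') (isUnit_iff_ne_zero.mpr hdet)
  have h2 := congrFun (congrFun this i) j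
  rw [invMetric, metricMatrix_localConformal]
  exact h2

theorem dx_exp_mul {f : E n → E n → ℝ} (hs : DifferentiableAt ℝ s x)
    (hf : DifferentiableAt ℝ (fun x => f x y) x) (r : Fin n) :
    dx r (fun x y => Real.exp (2 * s x) * f x y) x y =
      Real.exp (2 * s x) * (2 * fderiv ℝ s x (e r) * f x y + dx r f x y) := by
  have h := (((hs.hasFDerivAt.const_mul 2).exp).mul hf.hasFDerivAt).fderiv
  have h2 : dx r (fun x y => Real.exp (2 * s x) * f x y) x y = _ := congrArg (· (e r)) h
  rw [h2, dx]
  simp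
  ring

namespace IsLocalFinsler

theorem smooth_sq (hF : IsLocalFinsler U F) :
    ContDiffOn ℝ ∞ (fun p : E n × E n => sq F p.1 p.2) (U ×ˢ {0}ᶜ) :=
  hF.smooth.pow 2

theorem smoothOff_spray (hF : IsLocalFinsler U F) (hx : x ∈ U) (i : Fin n) :
    SmoothOff (spray F i x) := by
  refine (SmoothOff.const (1 / 4)).mul (SmoothOff.sum fun h _ => ?_)
  refine (hF.smoothOff_invMetric hx i h).mul (SmoothOff.sub (SmoothOff.sum fun r _ => ?_) ?_)
  · exact (SmoothOff.coord r).mul (smoothOff_of_joint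
      (joint_dx hF.isOpen (joint_dy hF.isOpen hF.smooth_sq h) r) hx)
  · exact smoothOff_of_joint (joint_dx hF.isOpen hF.smooth_sq h) hx

/-- The change of the geodesic coefficients under a conformal change. -/
theorem spray_localConformal (hF : IsLocalFinsler U F) (hs : DifferentiableAt ℝ s x) (hx : x ∈ U)
    (hy : y ≠ 0) (i : Fin n) :
    spray (localConformal s F) i x y =
      spray F i x y + ((∑ r, fderiv ℝ s x (e r) * y r) * y i
        + ∑ r, -(1 / 2) * fderiv ℝ s x (e r) * (sq F x y * invMetric F i r x y)) := by
  have h1 : ∀ r h, dx r (dy h (sq (localConformal s F))) x y =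
      Real.exp (2 * s x) * (2 * fderiv ℝ s x (e r) * pd h (sq F x) y + dx r (dy h (sq F)) x y) :=
    fun r h => by
      rw [dy_sq_localConformal]
      exact dx_exp_mul hs (differentiableAt_of_joint hF.isOpen
        (joint_dy hF.isOpen hF.smooth_sq h) hx hy) r
  have h2 : ∀ h, dx h (sq (localConformal s F)) x y =
      Real.exp (2 * s x) * (2 * fderiv ℝ s x (e h) * sq F x y + dx h (sq F) x y) := fun h => by
    rw [sq_localConformal]
    exact dx_exp_mul hs (differentiableAt_of_joint hF.isOpen hF.smooth_sq hx hy) h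
  have h3 : ∀ h, invMetric (localConformal s F) i h x y *
      ((∑ r, y r * dx r (dy h (sq (localConformal s F))) x y)
        - dx h (sq (localConformal s F)) x y) =
      invMetric F i h x y * ((∑ r, y r * dx r (dy h (sq F)) x y) - dx h (sq F) x y)
        + 2 * (∑ r, fderiv ℝ s x (e r) * y r) * (invMetric F i h x y * pd h (sq F x) y)
        + -2 * fderiv ℝ s x (e h) * (sq F x y * invMetric F i h x y) := fun h => by
    have hsum : ∑ r, y r * dx r (dy h (sq (localConformal s F))) x y =
        Real.exp (2 * s x) * (2 * (∑ r, fderiv ℝ s x (e r) * y r) * pd h (sq F x) y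
          + ∑ r, y r * dx r (dy h (sq F)) x y) := by
      simp only [h1, mul_add, Finset.mul_sum, Finset.sum_mul, ← Finset.sum_add_distrib]
      refine Finset.sum_congr rfl fun r _ => ?_
      ring
    rw [hsum, h2, invMetric_localConformal (hF.det_ne_zero hx hy)]
    field_simp [(Real.exp_pos (2 * s x)).ne']
    ring
  -- In `h3` the factors $e^{\pm 2s}$ have cancelled. The coefficients are $\frac14\cdot 2\cdot 2 =
  -- 1$ for $\sigma_r y^r y^i$ and $\frac14\cdot(-2) = -\frac12$ for $\sigma_r F^2 g^{ir}$.
  simp only [spray, h3, Finset.sum_add_distrib, ← Finset.mul_sum, hF.sum_invMetric_mul_pd_sq hx hy]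
  have h4 : ∀ c : ℝ, ∑ r, c * fderiv ℝ s x (e r) * (sq F x y * invMetric F i r x y) =
      c * ∑ r, fderiv ℝ s x (e r) * (sq F x y * invMetric F i r x y) := fun c => by
    simp only [Finset.mul_sum, mul_assoc]
  rw [h4, h4]
  ring

/-- The change of the Berwald tensor under a conformal change. -/
theorem berwald_localConformal (hF : IsLocalFinsler U F) (hs : DifferentiableAt ℝ s x)
    (hx : x ∈ U) (hy : y ≠ 0) (i j k h : Fin n) :
    berwald (localConformal s F) i j k h x y = berwald F i j k h x y
      + ∑ r, -(1 / 2) * fderiv ℝ s x (e r) *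
          pd h (pd k (pd j (fun y => sq F x y * invMetric F i r x y))) y := by
  have hA := fun r => (hF.smoothOff_sq hx).mul (hF.smoothOff_invMetric hx i r)
  have hB := fun r => (SmoothOff.const (-(1 / 2) * fderiv ℝ s x (e r))).mul (hA r)
  have hS : SmoothOff (fun y : E n => ∑ r, fderiv ℝ s x (e r) * y r) :=
    SmoothOff.sum fun r _ => (SmoothOff.const _).mul (SmoothOff.coord r)
  change pd h (pd k (pd j (spray (localConformal s F) i x))) y =
    pd h (pd k (pd j (spray F i x))) y + _
  rw [pd_pd_pd_congr (fun _ hy => hF.spray_localConformal hs hx hy i) j k h hy,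
    pd_pd_pd_add (hF.smoothOff_spray hx i)
      ((hS.mul (SmoothOff.coord i)).add (SmoothOff.sum fun r _ => hB r)) j k h hy,
    pd_pd_pd_add (hS.mul (SmoothOff.coord i)) (SmoothOff.sum fun r _ => hB r) j k h hy,
    pd_pd_pd_linear_mul_coord _ i j k h hy, pd_pd_pd_sum (fun r _ => hB r) j k h hy, zero_add]
  simp only [pd_pd_pd_const_mul]

/-- The change of the Landsberg tensor under a conformal change, in local coordinates. -/
theorem landsberg_localConformal (hF : IsLocalFinsler U F) (hs : DifferentiableAt ℝ s x)
    (hx : x ∈ U) (hy : y ≠ 0) (j k h : Fin n) :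
    landsberg (localConformal s F) j k h x y =
      Real.exp (2 * s x) * landsberg F j k h x y
        + Real.exp (2 * s x) * F x y *
          ∑ r, fderiv ℝ s x (e r) * tTensorUp F r j k h x y := by
  have key : ∑ i, F x y * ell F i x y * ∑ r, -(1 / 2) * fderiv ℝ s x (e r) *
      pd h (pd k (pd j (fun y => sq F x y * invMetric F i r x y))) y =
      -2 * F x y * ∑ r, fderiv ℝ s x (e r) * tTensorUp F r j k h x y := by
    simp only [Finset.mul_sum]
    rw [Finset.sum_comm]
    refine Finset.sum_congr rfl fun r _ => ?_
    have := hF.sum_mul_ell_mul_pd_pd_pd hx hy r j k h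
    calc _ = -(1 / 2) * fderiv ℝ s x (e r) * ∑ i, F x y * ell F i x y *
          pd h (pd k (pd j (fun y => sq F x y * invMetric F i r x y))) y := by
          rw [Finset.mul_sum]
          exact Finset.sum_congr rfl fun _ _ => by ring
      _ = _ := by rw [this]; ring
  have h1 : landsberg (localConformal s F) j k h x y =
      -(1 / 2) * Real.exp (2 * s x) * (F x y * ∑ i, ell F i x y * berwald F i j k h x y
        + ∑ i, F x y * ell F i x y * ∑ r, -(1 / 2) * fderiv ℝ s x (e r) *
          pd h (pd k (pd j (fun y => sq F x y * invMetric F i r x y))) y) := by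
    rw [two_mul, Real.exp_add]
    simp only [landsberg, ell_localConformal, hF.berwald_localConformal hs hx hy, localConformal]
    rw [Finset.mul_sum (a := F x y), ← Finset.sum_add_distrib, Finset.mul_sum, Finset.mul_sum]
    exact Finset.sum_congr rfl fun _ _ => by ring
  rw [h1, key, landsberg]
  ring

end IsLocalFinsler

end Conformal

/-! ### Passage between the manifold and its charts -/

section Global

variable {M : Type*} [TopologicalSpace M] [ChartedSpace (E n) M]
  {F : TangentBundle (𝓡 n) M → ℝ} {φ : OpenPartialHomeomorph M (E n)}

/-- An inverse chart has injective differential, so `y ≠ 0` stays off the zero section, where `F` is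
positive and smooth. -/
theorem mfderiv_symm_ne_zero (hφ : φ ∈ IsManifold.maximalAtlas (𝓡 n) ∞ M) {x : E n}
    (hx : x ∈ φ.target) {y : E n} (hy : y ≠ 0) : mfderiv (𝓡 n) (𝓡 n) φ.symm x y ≠ 0 := by
  have hd : φ.MDifferentiable (𝓡 n) (𝓡 n) :=
    ⟨(contMDiffOn_of_mem_maximalAtlas hφ).mdifferentiableOn (by simp),
      (contMDiffOn_symm_of_mem_maximalAtlas hφ).mdifferentiableOn (by simp)⟩
  intro h
  exact hy (hd.symm.mfderiv_injective hx (h.trans (map_zero _).symm))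

variable [IsManifold (𝓡 n) ∞ M]

/-- The vector `yⁱ ∂/∂xⁱ` at the point with coordinates `x` depends smoothly on `(x, y)`. -/
theorem contMDiffOn_coord_tangent (hφ : φ ∈ IsManifold.maximalAtlas (𝓡 n) ∞ M) :
    ContMDiffOn 𝓘(ℝ, E n × E n) (𝓡 n).tangent ∞
      (fun p : E n × E n => (⟨φ.symm p.1, mfderiv (𝓡 n) (𝓡 n) φ.symm p.1 p.2⟩ :
        TangentBundle (𝓡 n) M)) (φ.target ×ˢ Set.univ) := by
  have : IsManifold (𝓡 n) 1 M := IsManifold.of_le (n := ∞) (by norm_cast)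
  have hs : ContMDiffOn (𝓡 n) (𝓡 n) ∞ φ.symm φ.target := contMDiffOn_symm_of_mem_maximalAtlas hφ
  -- The map is the tangent map of `φ.symm` after the identification of `E n × E n` with the tangent
  -- bundle of `E n`.
  have h1 := hs.contMDiffOn_tangentMapWithin (m := ∞) (by simp) φ.open_target.uniqueMDiffOn
  have h2 : ContMDiff 𝓘(ℝ, E n × E n) (𝓡 n).tangent ∞
      (fun p : E n × E n => (⟨p.1, p.2⟩ : TangentBundle (𝓡 n) (E n))) := by
    have := contMDiff_tangentBundleModelSpaceHomeomorph_symm (I := 𝓡 n) (n := ∞)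
    rw [modelWithCornersSelf_prod]
    exact this
  refine (h1.comp (h2.contMDiffOn (s := φ.target ×ˢ Set.univ)) fun p hp => hp.1).congr fun p hp => ?_
  have h3 := tangentMapWithin_eq_tangentMap (I := 𝓡 n) (I' := 𝓡 n) (f := φ.symm)
    (p := (⟨p.1, p.2⟩ : TangentBundle (𝓡 n) (E n)))
    (φ.open_target.uniqueMDiffWithinAt hp.1)
    ((hs.contMDiffAt (φ.open_target.mem_nhds hp.1)).mdifferentiableAt (by simp))
  exact h3.symm

theorem IsFinslerStructure.isLocalFinsler (hF : IsFinslerStructure F)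
    (hφ : φ ∈ IsManifold.maximalAtlas (𝓡 n) ∞ M) :
    IsLocalFinsler φ.target (coordExpr F φ) where
  isOpen := φ.open_target
  pos x hx y hy := lt_of_le_of_ne (hF.nonneg _) fun h =>
    mfderiv_symm_ne_zero hφ hx hy ((hF.eq_zero_iff _).mp h.symm)
  homogeneous x _ c y hc :=
    (congrArg (fun v => F ⟨φ.symm x, v⟩) ((mfderiv (𝓡 n) (𝓡 n) φ.symm x).map_smul c y)).trans
      (hF.homogeneous _ _ c hc)
  smooth := by
    have h := hF.smooth.comp ((contMDiffOn_coord_tangent hφ).mono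
      (Set.prod_mono_right (Set.subset_univ ({0}ᶜ : Set (E n)))))
      fun p hp => mfderiv_symm_ne_zero hφ hp.1 hp.2
    exact h.contDiffOn
  posDef := hF.posDef φ hφ

/-- Needed for the converse implication, since `IsLandsbergian` includes being a Finsler structure.
-/
theorem IsFinslerStructure.conformal (hF : IsFinslerStructure F) {σ : M → ℝ}
    (hσ : ContMDiff (𝓡 n) 𝓘(ℝ, ℝ) ∞ σ) : IsFinslerStructure (conformal σ F) where
  nonneg v := mul_nonneg (Real.exp_pos _).le (hF.nonneg v)
  eq_zero_iff v := by
    rw [← hF.eq_zero_iff v, Finsler.conformal, mul_eq_zero]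
    simp [Real.exp_ne_zero]
  smooth := by
    have h1 : ContMDiff (𝓡 n).tangent 𝓘(ℝ, ℝ) ∞
        (fun v : TangentBundle (𝓡 n) M => Real.exp (σ v.proj)) :=
      Real.contDiff_exp.contMDiff.comp (hσ.comp (Bundle.contMDiff_proj _))
    exact h1.contMDiffOn.mul hF.smooth
  homogeneous p y c hc := by
    simp only [Finsler.conformal, hF.homogeneous p y c hc]
    ring
  posDef φ hφ x hx y hy :=
    posDef_localConformal (s := fun x => σ (φ.symm x)) (hF.posDef φ hφ x hx y hy)

end Global

end Finsler

end

theorem mainTheorem2 {n : ℕ} {M : Type*} [TopologicalSpace M] [ChartedSpace (Finsler.E n) M]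
    [IsManifold (𝓡 n) ∞ M]
    (F : TangentBundle (𝓡 n) M → ℝ) (hF : Finsler.IsFinslerStructure F)
    (σ : M → ℝ) (hσ : ContMDiff (𝓡 n) 𝓘(ℝ, ℝ) ∞ σ) :
    (∀ φ ∈ IsManifold.maximalAtlas (𝓡 n) ∞ M, ∀ x ∈ φ.target, ∀ y : Finsler.E n, y ≠ 0 →
      ∀ j k h : Fin n,
        Finsler.landsberg (Finsler.coordExpr (Finsler.conformal σ F) φ) j k h x y =
          Real.exp (2 * σ (φ.symm x)) * Finsler.landsberg (Finsler.coordExpr F φ) j k h x y +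
          Real.exp (2 * σ (φ.symm x)) * Finsler.coordExpr F φ x y *
            ∑ r, Finsler.dsigma σ φ r x *
              Finsler.tTensorUp (Finsler.coordExpr F φ) r j k h x y) ∧
    (Finsler.IsLandsbergian F →
      (Finsler.IsLandsbergian (Finsler.conformal σ F) ↔
        ∀ φ ∈ IsManifold.maximalAtlas (𝓡 n) ∞ M, ∀ x ∈ φ.target, ∀ y : Finsler.E n, y ≠ 0 →
          ∀ j k h : Fin n,
            ∑ r, Finsler.dsigma σ φ r x *
              Finsler.tTensorUp (Finsler.coordExpr F φ) r j k h x y = 0)) := by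
  have key : ∀ φ ∈ IsManifold.maximalAtlas (𝓡 n) ∞ M, ∀ x ∈ φ.target, ∀ y : Finsler.E n, y ≠ 0 →
      ∀ j k h : Fin n,
        Finsler.landsberg (Finsler.coordExpr (Finsler.conformal σ F) φ) j k h x y =
          Real.exp (2 * σ (φ.symm x)) * Finsler.landsberg (Finsler.coordExpr F φ) j k h x y +
          Real.exp (2 * σ (φ.symm x)) * Finsler.coordExpr F φ x y *
            ∑ r, Finsler.dsigma σ φ r x *
              Finsler.tTensorUp (Finsler.coordExpr F φ) r j k h x y := by
    intro φ hφ x hx y hy j k h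
    have hs : DifferentiableAt ℝ (fun x' => σ (φ.symm x')) x :=
      ((hσ.comp_contMDiffOn (contMDiffOn_symm_of_mem_maximalAtlas hφ)).contDiffOn.contDiffAt
        (φ.open_target.mem_nhds hx)).differentiableAt (by simp)
    -- The coordinate expression of `conformal σ F` is by definition the local conformal change of
    -- `coordExpr F φ` by `σ ∘ φ.symm`.
    exact (hF.isLocalFinsler hφ).landsberg_localConformal hs hx hy j k h
  refine ⟨key, fun hL => ⟨fun hL' φ hφ x hx y hy j k h => ?_,
    fun hT => ⟨hF.conformal hσ, fun φ hφ x hx y hy j k h => ?_⟩⟩⟩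
  · have := key φ hφ x hx y hy j k h
    rw [hL'.2 φ hφ x hx y hy, hL.2 φ hφ x hx y hy, mul_zero, zero_add] at this
    exact (mul_eq_zero.mp this.symm).resolve_left
      (mul_pos (Real.exp_pos _) ((hF.isLocalFinsler hφ).pos x hx y hy)).ne'
  · rw [key φ hφ x hx y hy, hL.2 φ hφ x hx y hy, hT φ hφ x hx y hy, mul_zero, mul_zero, add_zero]
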